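/- A pair $B\subseteq A$ of $\mathrm{C}^*$-algebras is called a \emph{Roe Cartan pair} if: (i) $A$ is unital; (ii) $A$ contains the $\mathrm{C}^*$-algebra of compact operators on a separable infinite-dimensional Hilbert space as an essential ideal (up to $^*$-isomorphism); (iii) $B$ is a Cartan subalgebra of $A$, i.e. a $\mathrm{C}^*$-subalgebra which is a maximal abelian self-adjoint subalgebra of $A$, contains an approximate unit for $A$, whose normaliser $\{a\in A: aBa^*\cup a^*Ba\subseteq B\}$ generates $A$ as a $\mathrm{C}^*$-algebra, and onto which there is a faithful conditional expectation $A\to B$; moreover $B$ is co-separable, i.e. there is a countable set $S\subseteq A$ such that $A$ is generated as a $\mathrm{C}^*$-algebra by $S\cup B$; and $B$ is abstractly $^*$-isomorphic to $\ell^\infty(\mathbb N)$. A metric space $Y$ has \emph{bounded geometry} if for every $r>0$ there is $n_r\in\mathbb N$ such that all balls of radius $r$ in $Y$ have at most $n_r$ elements. For such $Y$, the \emph{uniform Roe algebra} $C^*_u(Y)$ is the operator-norm closure of the set of bounded operators $a=(a_{xy})_{x,y\in Y}$ on $\ell^2(Y)$ of finite propagation, that is, with $\sup\{d(x,y): a_{xy}\neq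 0\}<\infty$; and $\ell^\infty(Y)$ is regarded as the algebra of multiplication operators on $\ell^2(Y)$. \textbf{Theorem B.} Let $B\subseteq A$ be a Roe Cartan pair. Then there exists a bounded geometry metric space $Y$ such that for any irreducible and faithful representation of $A$ on a Hilbert space $H$ there is a unitary isomorphism $v:\ell^2(Y)\to H$ such that (identifying $A$ with its image in $\mathcal B(H)$) $$v^*Bv=\ell^\infty(Y)\quad\text{and}\quad v^*Av=C^*_u(Y).$$ -/

import Mathlib

open scoped ENNReal

universe u v w

noncomputable section

namespace RoeCartan

/-! ### Cartan subalgebras of C*-algebras -/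

section Cartan

variable {A : Type u} [NonUnitalCStarAlgebra A]

/-- A C*-subalgebra is a norm-closed `*`-subalgebra; this is the C*-subalgebra generated by a
set `S`. (No unit is assumed, and subalgebras need not contain a unit of `A`.) -/
def generatedCStarSubalgebra (S : Set A) : NonUnitalStarSubalgebra ℂ A :=
  (NonUnitalStarAlgebra.adjoin ℂ S).topologicalClosure

/-- `B` is commutative. -/
def IsAbelian (B : NonUnitalStarSubalgebra ℂ A) : Prop :=
  ∀ x ∈ B, ∀ y ∈ B, x * y = y * x

/-- `B` is a maximal abelian self-adjoint subalgebra of `A`. -/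
def IsMASA (B : NonUnitalStarSubalgebra ℂ A) : Prop :=
  IsAbelian B ∧ ∀ C : NonUnitalStarSubalgebra ℂ A, IsAbelian C → B ≤ C → C = B

/-- `B` contains an approximate unit for `A`: a net in `B` (encoded by a proper filter
concentrated on `B`) along which left and right multiplication converge pointwise in norm to the
identity of `A`. -/
def ContainsApproximateUnit (B : NonUnitalStarSubalgebra ℂ A) : Prop :=
  ∃ l : Filter A, l.IsApproximateUnit ∧ ∀ᶠ b in l, b ∈ B

/-- The normaliser `{a ∈ A | a B a* ∪ a* B a ⊆ B}` of `B` in `A`. -/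
def normaliser (B : NonUnitalStarSubalgebra ℂ A) : Set A :=
  {a | ∀ b ∈ B, a * b * star a ∈ B ∧ star a * b * a ∈ B}

/-- `E` is a conditional expectation of `A` onto `B`: a contractive positive linear projection
onto `B` which is a `B`-bimodule map. (Positive elements are those of the form `c* c`.) -/
structure IsConditionalExpectation (B : NonUnitalStarSubalgebra ℂ A) (E : A →ₗ[ℂ] B) :
    Prop where
  map_coe : ∀ b : B, E (b : A) = b
  contractive : ∀ a : A, ‖E a‖ ≤ ‖a‖
  positive : ∀ a : A, ∃ c : B, E (star a * a) = star c * c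
  map_mul_left : ∀ (b : B) (a : A), E ((b : A) * a) = b * E a
  map_mul_right : ∀ (a : A) (b : B), E (a * (b : A)) = E a * b

/-- A linear map is faithful if it does not vanish on nonzero positive elements. -/
def IsFaithful {B : NonUnitalStarSubalgebra ℂ A} (E : A →ₗ[ℂ] B) : Prop :=
  ∀ a : A, E (star a * a) = 0 → a = 0

/-- `B` is a Cartan subalgebra of the C*-algebra `A`. -/
structure IsCartanSubalgebra (B : NonUnitalStarSubalgebra ℂ A) : Prop where
  isClosed : IsClosed (B : Set A)
  isMASA : IsMASA B
  approximateUnit : ContainsApproximateUnit B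
  regular : generatedCStarSubalgebra (normaliser B) = ⊤
  expectation : ∃ E : A →ₗ[ℂ] B, IsConditionalExpectation B E ∧ IsFaithful E

/-- `B` is co-separable in `A`: `A` is generated as a C*-algebra by `B` and a countable set. -/
def IsCoseparable (B : NonUnitalStarSubalgebra ℂ A) : Prop :=
  ∃ S : Set A, S.Countable ∧ generatedCStarSubalgebra (S ∪ (B : Set A)) = ⊤

end Cartan

/-! ### Essential ideals of compact operators -/

section Compacts

variable {A : Type u} [NonUnitalCStarAlgebra A]

/-- `I` is an essential (closed, two-sided, self-adjoint) ideal of `A`: its annihilator is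
zero. -/
structure IsEssentialIdeal (I : NonUnitalStarSubalgebra ℂ A) : Prop where
  isClosed : IsClosed (I : Set A)
  mul_mem_left : ∀ a : A, ∀ x ∈ I, a * x ∈ I
  mul_mem_right : ∀ a : A, ∀ x ∈ I, x * a ∈ I
  essential : ∀ a : A, (∀ x ∈ I, a * x = 0) → a = 0

/-- `I` is abstractly `*`-isomorphic to the C*-algebra of compact operators on the Hilbert space
`K`: there is an injective `*`-homomorphism of `I` into the bounded operators on `K` with image
exactly the compact operators. -/
def IsIsomorphicToCompacts (I : NonUnitalStarSubalgebra ℂ A) (K : Type w)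
    [NormedAddCommGroup K] [InnerProductSpace ℂ K] [CompleteSpace K] : Prop :=
  ∃ ι : I →⋆ₙₐ[ℂ] (K →L[ℂ] K),
    Function.Injective ι ∧ Set.range ι = {T : K →L[ℂ] K | IsCompactOperator T}

/-- `A` contains the compact operators on some separable infinite-dimensional Hilbert space as an
essential ideal. -/
def ContainsCompactsEssentially (A : Type u) [NonUnitalCStarAlgebra A] : Prop :=
  ∃ (K : Type w) (_ : NormedAddCommGroup K) (_ : InnerProductSpace ℂ K) (_ : CompleteSpace K)
    (I : NonUnitalStarSubalgebra ℂ A),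
    TopologicalSpace.SeparableSpace K ∧ ¬ FiniteDimensional ℂ K ∧
      IsEssentialIdeal I ∧ IsIsomorphicToCompacts I K

/-- `B ⊆ A` is a Roe Cartan pair. Unitality of `A` is part of `CStarAlgebra A`. -/
structure IsRoeCartanPair {A : Type u} [CStarAlgebra A] (B : NonUnitalStarSubalgebra ℂ A) :
    Prop where
  compacts : ContainsCompactsEssentially.{u, w} A
  cartan : IsCartanSubalgebra B
  coseparable : IsCoseparable B
  iso_ellInfty : Nonempty (B ≃⋆ₐ[ℂ] lp (fun _ : ℕ => ℂ) ∞)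

end Compacts

/-! ### Irreducible representations -/

/-- A `*`-representation of `A` on a Hilbert space `H` is irreducible if it is nonzero and the
only closed invariant subspaces are `0` and `H`. -/
def IsIrreducibleRep {A : Type u} [NonUnitalCStarAlgebra A] {H : Type v} [NormedAddCommGroup H]
    [InnerProductSpace ℂ H] [CompleteSpace H] (π : A →⋆ₙₐ[ℂ] (H →L[ℂ] H)) : Prop :=
  (∃ a, π a ≠ 0) ∧
    ∀ M : Submodule ℂ H, IsClosed (M : Set H) → (∀ a : A, ∀ ξ ∈ M, π a ξ ∈ M) →
      M = ⊥ ∨ M = ⊤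

/-! ### Bounded geometry metric spaces and uniform Roe algebras -/

/-- A metric space has bounded geometry if, for each `r > 0`, the cardinalities of the balls of
radius `r` are uniformly bounded. -/
def BoundedGeometry (Y : Type u) [MetricSpace Y] : Prop :=
  ∀ r : ℝ, 0 < r → ∃ n : ℕ, ∀ y : Y, (Metric.closedBall y r).encard ≤ n

/-- The Hilbert space `ℓ²(Y)`. -/
abbrev EllTwo (Y : Type u) : Type u := lp (fun _ : Y => ℂ) 2

open scoped Classical in
/-- The canonical basis vector `δ_y` of `ℓ²(Y)`. -/
def delta {Y : Type u} (y : Y) : EllTwo Y := lp.single 2 y (1 : ℂ)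

/-- The matrix entry `a_{xy} = ⟨δ_x, a δ_y⟩` (inner products are conjugate linear in the first
variable). -/
def matrixEntry {Y : Type u} (a : EllTwo Y →L[ℂ] EllTwo Y) (x y : Y) : ℂ :=
  inner ℂ (delta x) (a (delta y))

/-- The multiplication operator on `ℓ²(Y)` by a bounded function `f`. -/
def mulOperator {Y : Type u} (f : lp (fun _ : Y => ℂ) ∞) : EllTwo Y →L[ℂ] EllTwo Y :=
  lp.mapCLM 2 (fun y => f y • ContinuousLinearMap.id ℂ ℂ) (norm_nonneg f) (fun y => by
    refine (norm_smul_le _ _).trans ?_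
    rw [ContinuousLinearMap.norm_id, mul_one]
    exact lp.norm_apply_le_norm ENNReal.top_ne_zero f y)

theorem mulOperator_apply {Y : Type u} (f : lp (fun _ : Y => ℂ) ∞) (ξ : EllTwo Y) (y : Y) :
    mulOperator f ξ y = f y * ξ y := rfl

/-- `ℓ^∞(Y)` as the algebra of multiplication operators on `ℓ²(Y)`. -/
def ellInftyOperators (Y : Type u) : Set (EllTwo Y →L[ℂ] EllTwo Y) :=
  Set.range (mulOperator (Y := Y))

section Roe

variable {Y : Type u} [MetricSpace Y]

/-- The propagation `sup {d(x,y) | a_{xy} ≠ 0} ∈ [0, ∞]` of an operator `a` on `ℓ²(Y)`. -/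
def propagation (a : EllTwo Y →L[ℂ] EllTwo Y) : ℝ≥0∞ :=
  ⨆ (x : Y) (y : Y) (_ : matrixEntry a x y ≠ 0), edist x y

variable (Y) in
/-- The uniform Roe algebra `C*_u(Y)`: the operator-norm closure of the set of bounded operators
on `ℓ²(Y)` of finite propagation. -/
def uniformRoeAlgebra : Set (EllTwo Y →L[ℂ] EllTwo Y) :=
  closure {a | propagation a < ∞}

end Roe

end RoeCartan

end

/-! An isomorphism of `B` with `ℓ^∞(ℕ)` supplies minimal projections `p_y`. Since `B` is maximal
abelian, every corner `p_y A p_y` is `ℂ p_y`, so `‖p_x a p_y‖` behaves like the modulus of a matrix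
entry before any representation is chosen. A normaliser has at most one nonzero entry in each row
and column (`eq_of_entry_ne_zero_left`, `eq_of_entry_ne_zero_right`): it is a weighted partial
bijection of the index set.

Regularity and co-separability give countably many normalisers that generate `A` together with `B`.
Primeness, the only use of the compact operators, makes every `p_x A p_y` nonzero, so normalisers
linking all pairs of points can be added. Entries of the `i`-th normaliser above `1 / (k + 1)`
define a relation. The metric is the shortest chain length, the steps of the relation coded by `(i,
k)` costing more as the code grows. Hence a ball of given radius involves finitely many relations,
and is covered by finitely many products of normalisers with entries bounded below
(`isCovered_reach`). This yields bounded geometry, for a metric that depends on `B ⊆ A` alone.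

In a faithful irreducible representation each `p_y` is a rank one projection. Faithfulness of the
expectation forces their ranges to span a dense subspace, whence an orthonormal basis
(`exists_unitary`) in which `B` is diagonal. A finite propagation operator is supported on finitely
many normalisers and is a finite sum of terms `f s` with `f` in `ℓ^∞` (`mem_range_of_finite_cover`).
Conversely, a normaliser is a norm limit of its cut-downs to rows with large entries, which have
finite propagation (`rep_normaliser_mem`). -/

noncomputable section

namespace RoeCartan

/-! ### Diagonal embeddings of `ℓ^∞(Y)` -/

section Diagonal

variable {A : Type u} [CStarAlgebra A] {Y : Type v}

/-- The range of `j` is maximal abelian: it contains all self-adjoint elements of its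
commutant. -/
structure IsDiagonal (j : lp (fun _ : Y => ℂ) ∞ →⋆ₙₐ[ℂ] A) : Prop where
  injective : Function.Injective j
  maximal : ∀ a : A, IsSelfAdjoint a → (∀ f, a * j f = j f * a) → ∃ f, j f = a

open scoped Classical in
/-- The minimal projection of the diagonal at the point `y`. -/
def minProj (j : lp (fun _ : Y => ℂ) ∞ →⋆ₙₐ[ℂ] A) (y : Y) : A :=
  j (lp.single ∞ y (1 : ℂ))

/-- The modulus of the matrix entry of `a` at `(x, y)`. -/
def entry (j : lp (fun _ : Y => ℂ) ∞ →⋆ₙₐ[ℂ] A) (a : A) (x y : Y) : ℝ :=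
  ‖minProj j x * a * minProj j y‖

variable {j : lp (fun _ : Y => ℂ) ∞ →⋆ₙₐ[ℂ] A}

theorem minProj_mul_map (y : Y) (f : lp (fun _ : Y => ℂ) ∞) :
    minProj j y * j f = f y • minProj j y := by
  classical
  unfold minProj
  rw [← map_mul, ← map_smul]
  congr 1
  ext z
  by_cases h : z = y
  · subst h; simp [lp.infty_coeFn_mul]
  · simp [lp.infty_coeFn_mul, h]

theorem map_mul_minProj (y : Y) (f : lp (fun _ : Y => ℂ) ∞) :
    j f * minProj j y = f y • minProj j y := by
  rw [← minProj_mul_map]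
  unfold minProj
  rw [← map_mul, ← map_mul, mul_comm]

theorem star_minProj (y : Y) : star (minProj j y) = minProj j y := by
  classical
  unfold minProj
  rw [← map_star]
  congr 1
  ext z
  by_cases h : z = y
  · subst h; simp
  · simp [h]

theorem minProj_mul_self (y : Y) : minProj j y * minProj j y = minProj j y := by
  classical
  have := minProj_mul_map (j := j) y (lp.single ∞ y (1 : ℂ))
  rw [lp.single_apply_self, one_smul] at this
  exact this

theorem minProj_mul_of_ne {x y : Y} (h : x ≠ y) : minProj j x * minProj j y = 0 := by
  classical
  have := minProj_mul_map (j := j) x (lp.single ∞ y (1 : ℂ))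
  rw [lp.single_apply_ne _ _ _ h, zero_smul] at this
  exact this

theorem entry_nonneg (a : A) (x y : Y) : 0 ≤ entry j a x y := norm_nonneg _

theorem entry_ne_zero {a : A} {x y : Y} :
    entry j a x y ≠ 0 ↔ minProj j x * a * minProj j y ≠ 0 := norm_ne_zero_iff

theorem entry_star (a : A) (x y : Y) : entry j (star a) x y = entry j a y x := by
  unfold entry
  rw [← norm_star]
  simp [star_minProj, mul_assoc]

theorem entry_map_of_ne (f : lp (fun _ : Y => ℂ) ∞) {x y : Y} (h : x ≠ y) :
    entry j (j f) x y = 0 := by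
  unfold entry
  rw [minProj_mul_map, smul_mul_assoc, minProj_mul_of_ne h, smul_zero, norm_zero]

namespace IsDiagonal

variable (hj : IsDiagonal j)
include hj

theorem norm_map (f : lp (fun _ : Y => ℂ) ∞) : ‖j f‖ = ‖f‖ :=
  NonUnitalStarAlgHom.norm_map j hj.injective f

theorem norm_minProj (y : Y) : ‖minProj j y‖ = 1 := by
  classical
  unfold minProj
  rw [hj.norm_map, lp.norm_single (by simp)]
  simp

theorem minProj_ne_zero (y : Y) : minProj j y ≠ 0 := by
  rw [← norm_ne_zero_iff, hj.norm_minProj]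
  exact one_ne_zero

theorem apply_eq_zero {f : lp (fun _ : Y => ℂ) ∞} {y : Y} (h : minProj j y * j f = 0) :
    f y = 0 := by
  rw [minProj_mul_map] at h
  exact (smul_eq_zero.1 h).resolve_right (hj.minProj_ne_zero y)

/-- The commutant of the range is closed under `star`, so maximality applies to `a + star a` and `I
• (a - star a)`, from which `a` is recovered. -/
theorem exists_of_commute (a : A) (h : ∀ f, a * j f = j f * a) : ∃ f, j f = a := by
  have hs : ∀ f, star a * j f = j f * star a := fun f => by
    have := congrArg star (h (star f))
    simpa [map_star] using this.symm
  obtain ⟨f, hf⟩ := hj.maximal (a + star a) (IsSelfAdjoint.add_star_self a) fun f => by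
    rw [add_mul, mul_add, h, hs]
  obtain ⟨g, hg⟩ := hj.maximal (Complex.I • (a - star a))
    (by
      rw [IsSelfAdjoint, star_smul, star_sub, star_star]
      simp only [Complex.star_def, Complex.conj_I, neg_smul, smul_sub]
      abel) fun f => by
    rw [smul_mul_assoc, mul_smul_comm, sub_mul, mul_sub, h, hs]
  refine ⟨(2⁻¹ : ℂ) • (f - Complex.I • g), ?_⟩
  rw [map_smul, map_sub, map_smul, hf, hg, smul_smul, Complex.I_mul_I]
  rw [inv_smul_eq_iff₀ two_ne_zero, two_smul, neg_one_smul]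
  abel

theorem map_one : j 1 = 1 := by
  obtain ⟨f, hf⟩ := hj.exists_of_commute 1 (by simp)
  calc j 1 = j 1 * j f := by rw [hf, mul_one]
    _ = 1 := by rw [← map_mul, one_mul, hf]

/-- By `p_y j(f) = f(y) p_y` the compression commutes with the diagonal, hence belongs to it;
cutting by `p_y` once more leaves only its value at `y`. -/
theorem exists_corner (a : A) (y : Y) :
    ∃ c : ℂ, minProj j y * a * minProj j y = c • minProj j y := by
  obtain ⟨f, hf⟩ := hj.exists_of_commute (minProj j y * a * minProj j y) fun f => by
    calc _ = minProj j y * a * (minProj j y * j f) := mul_assoc _ _ _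
      _ = f y • (minProj j y * a * minProj j y) := by rw [minProj_mul_map, mul_smul_comm]
      _ = j f * minProj j y * a * minProj j y := by
          rw [map_mul_minProj, smul_mul_assoc, smul_mul_assoc]
      _ = _ := by simp only [mul_assoc]
  refine ⟨f y, ?_⟩
  rw [← minProj_mul_map, hf]
  simp only [← mul_assoc, minProj_mul_self]

/-- Matrix entries through the minimal projection at `y` are multiplicative. -/
theorem norm_mul_minProj_mul (a b : A) (y : Y) :
    ‖a * minProj j y * b‖ = ‖a * minProj j y‖ * ‖minProj j y * b‖ := by
  -- `(a p)* (a p) = c p`, so by the C*-identity `|c|` is the square of `‖a p‖`, and `c` factors out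
  -- of the second product.
  obtain ⟨c, hc⟩ := hj.exists_corner (star a * a) y
  have h1 : star (a * minProj j y) * (a * minProj j y) = c • minProj j y := by
    rw [← hc, star_mul, star_minProj]; simp only [mul_assoc]
  have hn : ‖a * minProj j y‖ * ‖a * minProj j y‖ = ‖c‖ := by
    rw [← CStarRing.norm_star_mul_self, h1, norm_smul, hj.norm_minProj, mul_one]
  have h2 : star (a * minProj j y * b) * (a * minProj j y * b) =
      c • (star (minProj j y * b) * (minProj j y * b)) := by
    calc _ = star b * (star (a * minProj j y) * (a * minProj j y)) * b := by
          simp only [star_mul, mul_assoc]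
      _ = _ := by
          rw [h1, star_mul, star_minProj]
          conv_lhs => rw [← minProj_mul_self y]
          simp only [mul_smul_comm, smul_mul_assoc, mul_assoc]
  rw [← mul_self_inj_of_nonneg (by positivity) (by positivity), ← CStarRing.norm_star_mul_self,
    h2, norm_smul, CStarRing.norm_star_mul_self, ← hn]
  ring

theorem entry_mul_minProj_mul (a b : A) (x y z : Y) :
    entry j (a * minProj j y * b) x z = entry j a x y * entry j b y z := by
  have := hj.norm_mul_minProj_mul (minProj j x * a) (b * minProj j z) y
  simpa only [entry, mul_assoc] using this

theorem entry_map_self (f : lp (fun _ : Y => ℂ) ∞) (y : Y) : entry j (j f) y y = ‖f y‖ := by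
  rw [entry, minProj_mul_map, smul_mul_assoc, minProj_mul_self, norm_smul, hj.norm_minProj,
    mul_one]

end IsDiagonal

/-! ### Normalisers of the diagonal -/

theorem star_mem_normaliser {B : NonUnitalStarSubalgebra ℂ A} {s : A} (hs : s ∈ normaliser B) :
    star s ∈ normaliser B := fun b hb => by
  rw [star_star]; exact (hs b hb).symm

theorem mul_mem_normaliser {B : NonUnitalStarSubalgebra ℂ A} {s t : A} (hs : s ∈ normaliser B)
    (ht : t ∈ normaliser B) : s * t ∈ normaliser B := fun b hb => by
  have h1 := (hs _ (ht b hb).1).1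
  have h2 := (ht _ (hs b hb).2).2
  simp only [star_mul]
  simp only [mul_assoc] at h1 h2 ⊢
  exact ⟨h1, h2⟩

variable {s t : A} (hs : s ∈ normaliser (NonUnitalStarAlgHom.range j))
include hs

theorem exists_map_eq (f : lp (fun _ : Y => ℂ) ∞) :
    (∃ g, j g = s * j f * star s) ∧ ∃ g, j g = star s * j f * s :=
  hs (j f) ⟨f, rfl⟩

namespace IsDiagonal

variable (hj : IsDiagonal j)
include hj

/-- `s p_y s*` lies in the diagonal, while the modulus of its entry at `(x, x')` is the product of
those of `s` at `(x, y)` and `(x', y)`. -/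
theorem eq_of_entry_ne_zero_left {x x' y : Y} (h : entry j s x y ≠ 0) (h' : entry j s x' y ≠ 0) :
    x = x' := by
  classical
  by_contra hx
  obtain ⟨g, hg⟩ := (exists_map_eq hs (lp.single ∞ y (1 : ℂ))).1
  have := hj.entry_mul_minProj_mul s (star s) x y x'
  rw [minProj, ← hg, entry_map_of_ne g hx, entry_star] at this
  exact mul_ne_zero h h' this.symm

theorem eq_of_entry_ne_zero_right {x y y' : Y} (h : entry j s x y ≠ 0)
    (h' : entry j s x y' ≠ 0) : y = y' := by
  rw [← entry_star] at h h'
  exact hj.eq_of_entry_ne_zero_left (star_mem_normaliser hs) h h'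

/-- Vanishing entries do not give a zero product formally, as `f` may have infinite support. Here
`s* p_x s = j g` with `|g(y)|` the squared entry of `s` at `(x, y)`, so `g f = 0` and the
C*-identity concludes. -/
theorem minProj_mul_mul_map_eq_zero (x : Y) (f : lp (fun _ : Y => ℂ) ∞)
    (h : ∀ y, f y ≠ 0 → entry j s x y = 0) : minProj j x * s * j f = 0 := by
  classical
  obtain ⟨g, hg⟩ := (exists_map_eq hs (lp.single ∞ x (1 : ℂ))).2
  have hgx : ∀ y, ‖g y‖ = entry j s x y * entry j s x y := fun y => by
    have := hj.entry_mul_minProj_mul (star s) s y x y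
    rwa [minProj, ← hg, hj.entry_map_self, entry_star] at this
  have h0 : g * f = 0 := by
    ext y
    rw [lp.infty_coeFn_mul, Pi.mul_apply]
    by_cases hf : f y = 0
    · simp [hf]
    · have := hgx y
      rw [h y hf, mul_zero, norm_eq_zero] at this
      simp [this]
  rw [← norm_eq_zero, ← mul_self_eq_zero, ← CStarRing.norm_star_mul_self, norm_eq_zero]
  calc star (minProj j x * s * j f) * (minProj j x * s * j f)
      = star (j f) * (star s * (minProj j x * minProj j x) * s) * j f := by
        simp only [star_mul, star_minProj, mul_assoc]
    _ = star (j f) * j (g * f) := by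
        rw [minProj_mul_self, map_mul, hg, mul_assoc (star (j f))]; rfl
    _ = 0 := by rw [h0, _root_.map_zero, mul_zero]

/-- The rest of row `x` is cut out by `1 - δ_y`, on whose support the row has no entries. Hence
entries of products factor through the single point `y`, without cancellation. -/
theorem minProj_mul_eq {x y : Y} (h : entry j s x y ≠ 0) :
    minProj j x * s = minProj j x * s * minProj j y := by
  classical
  have := hj.minProj_mul_mul_map_eq_zero hs x (1 - lp.single ∞ y (1 : ℂ)) fun z hz => by
    by_contra hzx
    have := hj.eq_of_entry_ne_zero_right hs h hzx
    subst this
    apply hz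
    rw [lp.coeFn_sub, Pi.sub_apply, lp.single_apply_self, lp.infty_coeFn_one, Pi.one_apply,
      sub_self]
  rw [map_sub, hj.map_one, mul_sub, mul_one, sub_eq_zero] at this
  exact this

theorem entry_mul {x y : Y} (h : entry j s x y ≠ 0) (z : Y) :
    entry j (s * t) x z = entry j s x y * entry j t y z := by
  rw [← hj.entry_mul_minProj_mul, entry, entry, ← mul_assoc, hj.minProj_mul_eq hs h]
  simp only [mul_assoc]

/-- Cutting down a normaliser to the rows on which it is small gives a small element. -/
theorem norm_map_mul_le {ε : ℝ} (hε : 0 ≤ ε) (f : lp (fun _ : Y => ℂ) ∞) (hf : ∀ x, ‖f x‖ ≤ 1)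
    (h : ∀ x, f x ≠ 0 → ‖minProj j x * s‖ ≤ ε) : ‖j f * s‖ ≤ ε := by
  -- `s s*` is diagonal with values of modulus `‖p_x s‖²`, so the squared norm is the supremum over
  -- `x` of `|f(x)|² ‖p_x s‖²`.
  obtain ⟨g, hg⟩ := (exists_map_eq hs 1).1
  rw [hj.map_one, mul_one] at hg
  have hgx : ∀ x, ‖g x‖ = ‖minProj j x * s‖ * ‖minProj j x * s‖ := fun x => by
    rw [← CStarRing.norm_self_mul_star, ← hj.entry_map_self, hg, entry, star_mul, star_minProj]
    simp only [mul_assoc]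
  have h1 : j f * s * star (j f * s) = j (f * g * star f) := by
    rw [_root_.map_mul, _root_.map_mul, hg, map_star]
    simp only [star_mul, mul_assoc]
  refine abs_le_of_sq_le_sq' ?_ hε |>.2
  rw [sq, ← CStarRing.norm_self_mul_star, h1, hj.norm_map]
  refine lp.norm_le_of_forall_le (by positivity) fun x => ?_
  rw [lp.infty_coeFn_mul, lp.infty_coeFn_mul, Pi.mul_apply, Pi.mul_apply, norm_mul, norm_mul,
    hgx, lp.star_apply, norm_star]
  by_cases hx : f x = 0
  · simp [hx]; positivity
  · have h3 := h x hx
    have h4 := hf x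
    calc ‖f x‖ * (‖minProj j x * s‖ * ‖minProj j x * s‖) * ‖f x‖
        ≤ 1 * (ε * ε) * 1 := by gcongr
      _ = ε ^ 2 := by ring

end IsDiagonal

end Diagonal

/-! ### The metric generated by a sequence of relations -/

section Reach

variable {Y : Type v}

/-- `x` and `z` are joined by a chain of total length `n`, where a step in the relation `R i` has
length `i + 1`. -/
inductive Reach (R : ℕ → Y → Y → Prop) : ℕ → Y → Y → Prop
  | refl (x : Y) : Reach R 0 x x
  | step {i n : ℕ} {x y z : Y} : R i x y → Reach R n y z → Reach R (n + (i + 1)) x z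

variable {R : ℕ → Y → Y → Prop}

theorem Reach.single {i : ℕ} {x y : Y} (h : R i x y) : Reach R (i + 1) x y := by
  simpa using Reach.step h (Reach.refl y)

theorem Reach.trans {n m : ℕ} {x y z : Y} (h : Reach R n x y) (h' : Reach R m y z) :
    Reach R (n + m) x z := by
  induction h with
  | refl x => simpa using h'
  | @step i n x y w hxy _ ih =>
    have := Reach.step hxy (ih h')
    rwa [show n + m + (i + 1) = n + (i + 1) + m by ring] at this

theorem Reach.symm (hR : ∀ i x y, R i x y → R i y x) {n : ℕ} {x y : Y} (h : Reach R n x y) :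
    Reach R n y x := by
  induction h with
  | refl x => exact .refl x
  | step hxy _ ih => exact ih.trans (Reach.single (hR _ _ _ hxy))

theorem Reach.zero_iff {x y : Y} : Reach R 0 x y ↔ x = y := by
  refine ⟨fun h => ?_, fun h => h ▸ .refl x⟩
  generalize hn : 0 = n at h
  cases h with
  | refl => rfl
  | step => omega

theorem Reach.cases_of_pos {n : ℕ} {x z : Y} (h : Reach R (n + 1) x z) :
    ∃ i < n + 1, ∃ y, R i x y ∧ Reach R (n - i) y z := by
  generalize hn : n + 1 = m at h
  cases h with
  | refl => omega
  | @step i k _ y _ hxy hyz =>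
    refine ⟨i, by omega, y, hxy, ?_⟩
    rwa [show n - i = k by omega]

variable (R) in
/-- The length of the shortest chain joining two points. -/
def chainDist (x y : Y) : ℕ := sInf {n | Reach R n x y}

theorem chainDist_le {n : ℕ} {x y : Y} (h : Reach R n x y) : chainDist R x y ≤ n :=
  Nat.sInf_le h

variable (hR : ∀ i x y, R i x y → R i y x) (htot : ∀ x y, ∃ i, R i x y)

-- Totality makes the set of lengths nonempty, so the default value `0` of `sInf ∅` never occurs.
include htot in
theorem reach_chainDist (x y : Y) : Reach R (chainDist R x y) x y := by
  obtain ⟨i, hi⟩ := htot x y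
  exact Nat.sInf_mem (s := {n | Reach R n x y}) ⟨i + 1, .single hi⟩

/-- The metric on `Y` given by the length of the shortest chain. -/
abbrev chainMetric : MetricSpace Y where
  dist x y := chainDist R x y
  dist_self x := by exact_mod_cast Nat.le_zero.1 (chainDist_le (.refl x))
  dist_comm x y := by
    exact_mod_cast le_antisymm (chainDist_le ((reach_chainDist htot y x).symm hR))
      (chainDist_le ((reach_chainDist htot x y).symm hR))
  dist_triangle x y z := by
    exact_mod_cast chainDist_le ((reach_chainDist htot x y).trans (reach_chainDist htot y z))
  eq_of_dist_eq_zero {x y} h := by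
    have h0 : chainDist R x y = 0 := by exact_mod_cast h
    exact Reach.zero_iff.1 (h0 ▸ reach_chainDist htot x y)

end Reach

/-! ### Relations covered by finitely many normalisers -/

section Covered

variable {A : Type u} [CStarAlgebra A] {Y : Type v}

/-- A relation is covered if it is contained in the union of the supports of finitely many
normalisers, with a uniform lower bound on the entries. -/
def IsCovered (j : lp (fun _ : Y => ℂ) ∞ →⋆ₙₐ[ℂ] A) (R : Y → Y → Prop) : Prop :=
  ∃ F : Set A, F.Finite ∧ F ⊆ normaliser (NonUnitalStarAlgHom.range j) ∧ ∃ ε : ℝ, 0 < ε ∧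
    ∀ x y, R x y → ∃ s ∈ F, ε ≤ entry j s x y

variable {j : lp (fun _ : Y => ℂ) ∞ →⋆ₙₐ[ℂ] A} {R R' : Y → Y → Prop}

theorem IsCovered.mono (h : IsCovered j R) (hR : ∀ x y, R' x y → R x y) : IsCovered j R' := by
  obtain ⟨F, hF, hFn, ε, hε, hc⟩ := h
  exact ⟨F, hF, hFn, ε, hε, fun x y h => hc x y (hR x y h)⟩

theorem IsCovered.or (h : IsCovered j R) (h' : IsCovered j R') :
    IsCovered j fun x y => R x y ∨ R' x y := by
  obtain ⟨F, hF, hFn, ε, hε, hc⟩ := h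
  obtain ⟨F', hF', hFn', ε', hε', hc'⟩ := h'
  refine ⟨F ∪ F', hF.union hF', Set.union_subset hFn hFn', min ε ε', lt_min hε hε', ?_⟩
  rintro x y (hxy | hxy)
  · obtain ⟨s, hs, hle⟩ := hc x y hxy
    exact ⟨s, .inl hs, (min_le_left _ _).trans hle⟩
  · obtain ⟨s, hs, hle⟩ := hc' x y hxy
    exact ⟨s, .inr hs, (min_le_right _ _).trans hle⟩

theorem IsCovered.exists_lt {R : ℕ → Y → Y → Prop} (n : ℕ) (h : ∀ i < n, IsCovered j (R i)) :
    IsCovered j fun x y => ∃ i < n, R i x y := by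
  induction n with
  | zero => exact ⟨∅, Set.finite_empty, Set.empty_subset _, 1, one_pos, by simp⟩
  | succ n ih =>
    refine ((ih fun i hi => h i (by omega)).or (h n (by omega))).mono ?_
    rintro x y ⟨i, hi, hxy⟩
    rcases Nat.lt_succ_iff_lt_or_eq.1 hi with hi | rfl
    · exact .inl ⟨i, hi, hxy⟩
    · exact .inr hxy

namespace IsDiagonal

variable (hj : IsDiagonal j)
include hj

theorem isCovered_eq : IsCovered j fun x y => x = y := by
  refine ⟨{1}, Set.finite_singleton 1, ?_, 1, one_pos, ?_⟩
  · rintro _ rfl b hb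
    simpa using hb
  · rintro x _ rfl
    exact ⟨1, rfl, by rw [entry, mul_one, minProj_mul_self, hj.norm_minProj]⟩

/-- Products of normalisers are normalisers, and their entries multiply exactly, so the lower bounds
multiply. -/
theorem isCovered_comp (h : IsCovered j R) (h' : IsCovered j R') :
    IsCovered j fun x z => ∃ y, R x y ∧ R' y z := by
  obtain ⟨F, hF, hFn, ε, hε, hc⟩ := h
  obtain ⟨F', hF', hFn', ε', hε', hc'⟩ := h'
  refine ⟨Set.image2 (· * ·) F F', hF.image2 _ hF', ?_, ε * ε', mul_pos hε hε', ?_⟩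
  · rintro _ ⟨s, hs, t, ht, rfl⟩
    exact mul_mem_normaliser (hFn hs) (hFn' ht)
  · rintro x z ⟨y, hxy, hyz⟩
    obtain ⟨s, hs, hle⟩ := hc x y hxy
    obtain ⟨t, ht, hle'⟩ := hc' y z hyz
    refine ⟨s * t, ⟨s, hs, t, ht, rfl⟩, ?_⟩
    rw [hj.entry_mul (hFn hs) (hε.trans_le hle).ne']
    exact mul_le_mul hle hle' hε'.le (entry_nonneg _ _ _)

/-- A step in `R i` has length `i + 1`, so a chain of length `n` uses only relations with `i < n`:
finitely many compositions suffice. -/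
theorem isCovered_reach {R : ℕ → Y → Y → Prop} (h : ∀ i, IsCovered j (R i)) (n : ℕ) :
    IsCovered j (Reach R n) := by
  induction n using Nat.strong_induction_on with
  | _ n ih =>
    cases n with
    | zero => exact hj.isCovered_eq.mono fun x y => Reach.zero_iff.1
    | succ n =>
      refine (IsCovered.exists_lt (n + 1) fun i _ =>
        hj.isCovered_comp (h i) (ih (n - i) (by omega))).mono fun x y => Reach.cases_of_pos

/-- Each normaliser of the cover has at most one nonzero entry in row `x`, so the size of the cover
bounds all rows at once. -/
theorem exists_encard_le (h : IsCovered j R) : ∃ n : ℕ, ∀ x, {y | R x y}.encard ≤ n := by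
  obtain ⟨F, hF, hFn, ε, hε, hc⟩ := h
  refine ⟨F.ncard, fun x => ?_⟩
  choose! g hgF hg using fun y => hc x y
  rw [hF.cast_ncard_eq]
  refine Set.encard_le_encard_of_injOn (f := g) (fun y hy => hgF y hy) fun y hy y' hy' he => ?_
  have h1 := hg y hy
  have h2 := hg y' hy'
  rw [← he] at h2
  exact hj.eq_of_entry_ne_zero_right (hFn (hgF y hy)) (hε.trans_le h1).ne' (hε.trans_le h2).ne'

end IsDiagonal

end Covered

/-! ### The relations of a sequence of normalisers -/

section SeqRel

variable {A : Type u} [CStarAlgebra A] {Y : Type v}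

/-- The relations, indexed by pairs `(i, k)`, of having an entry of `N i` of modulus at least
`1 / (k + 1)` in one of the two directions. -/
def seqRel (j : lp (fun _ : Y => ℂ) ∞ →⋆ₙₐ[ℂ] A) (N : ℕ → A) (i : ℕ) (x y : Y) : Prop :=
  1 / ((i.unpair.2 : ℝ) + 1) ≤ entry j (N i.unpair.1) x y ∨
    1 / ((i.unpair.2 : ℝ) + 1) ≤ entry j (N i.unpair.1) y x

variable {j : lp (fun _ : Y => ℂ) ∞ →⋆ₙₐ[ℂ] A} {N : ℕ → A}

theorem seqRel_symm (i : ℕ) (x y : Y) (h : seqRel j N i x y) : seqRel j N i y x := Or.symm h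

theorem seqRel_pair {i k : ℕ} {x y : Y} (h : 1 / ((k : ℝ) + 1) ≤ entry j (N i) x y) :
    seqRel j N (Nat.pair i k) x y := by
  left
  rwa [Nat.unpair_pair]

theorem seqRel_total (htot : ∀ x y, ∃ i, entry j (N i) x y ≠ 0) (x y : Y) :
    ∃ i, seqRel j N i x y := by
  obtain ⟨i, hi⟩ := htot x y
  obtain ⟨k, hk⟩ := exists_nat_one_div_lt ((entry_nonneg (j := j) (N i) x y).lt_of_ne' hi)
  exact ⟨_, seqRel_pair hk.le⟩

theorem isCovered_seqRel (hN : ∀ i, N i ∈ normaliser (NonUnitalStarAlgHom.range j)) (i : ℕ) :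
    IsCovered j (seqRel j N i) := by
  refine ⟨{N i.unpair.1, star (N i.unpair.1)}, by simp, ?_, 1 / ((i.unpair.2 : ℝ) + 1),
    by positivity, ?_⟩
  · rintro _ (rfl | rfl)
    · exact hN _
    · exact star_mem_normaliser (hN _)
  · rintro x y (h | h)
    · exact ⟨_, .inl rfl, h⟩
    · exact ⟨_, .inr rfl, by rwa [entry_star]⟩

end SeqRel

/-! ### Countable generation by normalisers -/

section Generation

variable {A : Type u} [NonUnitalCStarAlgebra A]

theorem generatedCStarSubalgebra_mono {S T : Set A} (h : S ⊆ T) :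
    generatedCStarSubalgebra S ≤ generatedCStarSubalgebra T :=
  NonUnitalStarSubalgebra.topologicalClosure_mono (NonUnitalStarAlgebra.adjoin_mono h)

theorem subset_generatedCStarSubalgebra (S : Set A) :
    S ⊆ (generatedCStarSubalgebra S : Set A) :=
  (NonUnitalStarAlgebra.subset_adjoin ℂ S).trans
    (NonUnitalStarSubalgebra.le_topologicalClosure _)

theorem generatedCStarSubalgebra_le {S : Set A} {C : NonUnitalStarSubalgebra ℂ A}
    (hC : IsClosed (C : Set A)) (h : S ⊆ C) : generatedCStarSubalgebra S ≤ C :=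
  NonUnitalStarSubalgebra.topologicalClosure_minimal _ (NonUnitalStarAlgebra.adjoin_le h) hC

theorem exists_countable_subset_adjoin {S : Set A} {a : A}
    (ha : a ∈ NonUnitalStarAlgebra.adjoin ℂ S) :
    ∃ T ⊆ S, T.Countable ∧ a ∈ NonUnitalStarAlgebra.adjoin ℂ T := by
  induction ha using NonUnitalStarAlgebra.adjoin_induction with
  | mem x hx =>
    exact ⟨{x}, by simpa using hx, Set.countable_singleton x,
      NonUnitalStarAlgebra.self_mem_adjoin_singleton ℂ x⟩
  | add x y _ _ hx hy =>
    obtain ⟨T, hT, hTc, hxT⟩ := hx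
    obtain ⟨T', hT', hTc', hyT⟩ := hy
    exact ⟨T ∪ T', Set.union_subset hT hT', hTc.union hTc',
      add_mem (NonUnitalStarAlgebra.adjoin_mono Set.subset_union_left hxT)
        (NonUnitalStarAlgebra.adjoin_mono Set.subset_union_right hyT)⟩
  | zero => exact ⟨∅, Set.empty_subset _, Set.countable_empty, zero_mem _⟩
  | mul x y _ _ hx hy =>
    obtain ⟨T, hT, hTc, hxT⟩ := hx
    obtain ⟨T', hT', hTc', hyT⟩ := hy
    exact ⟨T ∪ T', Set.union_subset hT hT', hTc.union hTc',
      mul_mem (NonUnitalStarAlgebra.adjoin_mono Set.subset_union_left hxT)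
        (NonUnitalStarAlgebra.adjoin_mono Set.subset_union_right hyT)⟩
  | smul r x _ hx =>
    obtain ⟨T, hT, hTc, hxT⟩ := hx
    exact ⟨T, hT, hTc, SMulMemClass.smul_mem r hxT⟩
  | star x _ hx =>
    obtain ⟨T, hT, hTc, hxT⟩ := hx
    exact ⟨T, hT, hTc, star_mem hxT⟩

theorem exists_countable_subset_generated {S : Set A} {a : A}
    (ha : a ∈ generatedCStarSubalgebra S) :
    ∃ T ⊆ S, T.Countable ∧ a ∈ generatedCStarSubalgebra T := by
  obtain ⟨u, hu, hlim⟩ := mem_closure_iff_seq_limit.1 ha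
  choose T hTS hTc hT using fun n => exists_countable_subset_adjoin (hu n)
  refine ⟨⋃ n, T n, Set.iUnion_subset hTS, Set.countable_iUnion hTc, ?_⟩
  exact mem_closure_of_tendsto hlim (.of_forall fun n =>
    NonUnitalStarAlgebra.adjoin_mono (Set.subset_iUnion T n) (hT n))

/-- In a regular co-separable inclusion, countably many normalisers and `B` generate. -/
theorem exists_countable_normalisers {B : NonUnitalStarSubalgebra ℂ A}
    (hreg : generatedCStarSubalgebra (normaliser B) = ⊤) (hsep : IsCoseparable B) :
    ∃ T ⊆ normaliser B, T.Countable ∧ generatedCStarSubalgebra (T ∪ (B : Set A)) = ⊤ := by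
  obtain ⟨S, hS, hgen⟩ := hsep
  choose T hTn hTc hT using fun a : A =>
    exists_countable_subset_generated (S := normaliser B) (a := a) (hreg ▸ trivial)
  refine ⟨⋃ a ∈ S, T a, Set.iUnion₂_subset fun a _ => hTn a, hS.biUnion fun a _ => hTc a, ?_⟩
  rw [eq_top_iff, ← hgen]
  refine generatedCStarSubalgebra_le isClosed_closure (Set.union_subset (fun a ha => ?_) ?_)
  · exact generatedCStarSubalgebra_mono
      ((Set.subset_biUnion_of_mem ha).trans Set.subset_union_left) (hT a)
  · exact Set.subset_union_right.trans (subset_generatedCStarSubalgebra _)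

end Generation

/-! ### Primeness -/

section Prime

theorem isCompactOperator_rankOne {K : Type w} [NormedAddCommGroup K] [InnerProductSpace ℂ K]
    (x y : K) : IsCompactOperator (InnerProductSpace.rankOne ℂ x y) :=
  ((isCompactOperator_id (E := ℂ)).clm_comp (ContinuousLinearMap.toSpanSingleton ℂ x)).comp_clm
    (innerSL ℂ y)

/-- A C*-algebra containing the compact operators essentially is prime. -/
theorem ContainsCompactsEssentially.exists_mul_mul_ne_zero {A : Type u} [NonUnitalCStarAlgebra A]
    (hA : ContainsCompactsEssentially.{u, w} A) {a b : A} (ha : a ≠ 0) (hb : b ≠ 0) :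
    ∃ c, a * c * b ≠ 0 := by
  obtain ⟨K, _, _, _, I, -, -, hI, ι, hι, hrange⟩ := hA
  obtain ⟨x, hx, hax⟩ : ∃ x ∈ I, a * x ≠ 0 := by
    by_contra! h
    exact ha (hI.essential a h)
  obtain ⟨y, hy, hby⟩ : ∃ y ∈ I, star b * y ≠ 0 := by
    by_contra! h
    exact hb (star_eq_zero.1 (hI.essential _ h))
  have hyb : star y * b ≠ 0 := fun h => hby (by simpa using congrArg star h)
  let p : I := ⟨a * x, hI.mul_mem_left a x hx⟩
  let q : I := ⟨star y * b, hI.mul_mem_right b _ (star_mem hy)⟩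
  have hp : ι p ≠ 0 := (map_ne_zero_iff ι hι).2 fun h => hax (congrArg Subtype.val h)
  have hq : ι q ≠ 0 := (map_ne_zero_iff ι hι).2 fun h => hyb (congrArg Subtype.val h)
  obtain ⟨ξ, hξ⟩ := DFunLike.ne_iff.1 hp
  obtain ⟨η, hη⟩ := DFunLike.ne_iff.1 hq
  -- This rank one operator maps `ι q η` to a nonzero multiple of `ξ`, which `ι p` does not kill.
  obtain ⟨z, hz⟩ : InnerProductSpace.rankOne ℂ ξ (ι q η) ∈ Set.range ι := by
    rw [hrange]
    exact isCompactOperator_rankOne _ _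
  refine ⟨x * z * star y, fun h => ?_⟩
  have h0 : p * z * q = 0 :=
    Subtype.ext (show a * x * z * (star y * b) = 0 by simpa only [mul_assoc] using h)
  have h1 : ι p (InnerProductSpace.rankOne ℂ ξ (ι q η) (ι q η)) = 0 := by
    have := congrArg (fun T => ι T η) h0
    simp only [map_mul, hz, map_zero] at this
    exact this
  rw [InnerProductSpace.rankOne_apply, map_smul] at h1
  rcases smul_eq_zero.1 h1 with h2 | h2
  · exact hη (inner_self_eq_zero.1 h2)
  · exact hξ h2

end Prime

/-! ### A connecting and generating sequence of normalisers -/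

section Sequence

variable {A : Type u} [CStarAlgebra A] {Y : Type v}
  {j : lp (fun _ : Y => ℂ) ∞ →⋆ₙₐ[ℂ] A}

/-- Conjugating the diagonal by `p_x a p_y` lands in the corner at `x`, which is scalar; the adjoint
has the same form. -/
theorem IsDiagonal.minProj_mul_mem_normaliser (hj : IsDiagonal j) (a : A) (x y : Y) :
    minProj j x * a * minProj j y ∈ normaliser (NonUnitalStarAlgHom.range j) := by
  have key : ∀ (a : A) (x y : Y) (f : lp (fun _ : Y => ℂ) ∞),
      minProj j x * a * minProj j y * j f * star (minProj j x * a * minProj j y) ∈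
        NonUnitalStarAlgHom.range j := fun a x y f => by
    obtain ⟨c, hc⟩ := hj.exists_corner (a * minProj j y * j f * minProj j y * star a) x
    have : minProj j x * a * minProj j y * j f * star (minProj j x * a * minProj j y) =
        c • minProj j x := by
      rw [← hc]
      simp only [star_mul, star_minProj, mul_assoc]
    rw [this]
    exact SMulMemClass.smul_mem c ⟨_, rfl⟩
  rintro _ ⟨f, rfl⟩
  refine ⟨key a x y f, ?_⟩
  have := key (star a) y x f
  simp only [star_mul, star_minProj, star_star, mul_assoc] at this ⊢
  exact this

/-- A sequence of normalisers which together with the diagonal generates, and which connects all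
pairs of points. -/
theorem exists_seq_normalisers [Countable Y] (hj : IsDiagonal j)
    (hA : ContainsCompactsEssentially.{u, w} A)
    (hreg : generatedCStarSubalgebra (normaliser (NonUnitalStarAlgHom.range j)) = ⊤)
    (hsep : IsCoseparable (NonUnitalStarAlgHom.range j)) :
    ∃ N : ℕ → A, (∀ i, N i ∈ normaliser (NonUnitalStarAlgHom.range j)) ∧
      (∀ x y, ∃ i, entry j (N i) x y ≠ 0) ∧
      generatedCStarSubalgebra (Set.range N ∪ Set.range j) = ⊤ := by
  obtain ⟨T, hTn, hTc, hT⟩ := exists_countable_normalisers hreg hsep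
  choose c hc using fun x y : Y =>
    hA.exists_mul_mul_ne_zero (hj.minProj_ne_zero x) (hj.minProj_ne_zero y)
  -- Adjoining `0` guarantees a nonempty set, as needed to enumerate it by `ℕ`.
  let U : Set A := T ∪ ({0} ∪ Set.range fun p : Y × Y => minProj j p.1 * c p.1 p.2 * minProj j p.2)
  have hUc : U.Countable :=
    hTc.union ((Set.countable_singleton 0).union (Set.countable_range _))
  obtain ⟨N, hN⟩ := hUc.exists_eq_range ⟨0, .inr (.inl rfl)⟩
  refine ⟨N, fun i => ?_, fun x y => ?_, ?_⟩
  · rcases (hN ▸ Set.mem_range_self i : N i ∈ U) with h | h | ⟨p, hp⟩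
    · exact hTn h
    · rw [show N i = 0 from h]
      intro b _
      simp
    · exact hp ▸ hj.minProj_mul_mem_normaliser _ _ _
  · obtain ⟨i, hi⟩ : minProj j x * c x y * minProj j y ∈ Set.range N :=
      hN ▸ .inr (.inr ⟨(x, y), rfl⟩)
    refine ⟨i, entry_ne_zero.2 ?_⟩
    rw [hi]
    simpa only [← mul_assoc, minProj_mul_self, mul_assoc _ (minProj j y) (minProj j y)] using hc x y
  · rw [eq_top_iff, ← hT]
    refine generatedCStarSubalgebra_mono (Set.union_subset_union_left _ ?_)
    rw [← hN]
    exact Set.subset_union_left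

end Sequence

/-! ### Irreducible representations -/

section Irreducible

variable {A : Type u} [NonUnitalCStarAlgebra A] {H : Type v} [NormedAddCommGroup H]
  [InnerProductSpace ℂ H] [CompleteSpace H] {π : A →⋆ₙₐ[ℂ] (H →L[ℂ] H)}

theorem rep_mul_apply (a b : A) (ξ : H) : π (a * b) ξ = π a (π b ξ) := by
  rw [map_mul]; rfl

theorem rep_inner_left (a : A) (ξ η : H) : inner ℂ (π a ξ) η = inner ℂ ξ (π (star a) η) := by
  rw [map_star, ContinuousLinearMap.star_eq_adjoint, ContinuousLinearMap.adjoint_inner_right]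

/-- In an irreducible representation, every vector not annihilated by the algebra is cyclic. -/
theorem IsIrreducibleRep.dense_orbit (hπ : IsIrreducibleRep π) {ξ : H} {a : A} (ha : π a ξ ≠ 0) :
    Dense (Set.range fun b => π b ξ) := by
  let L : A →ₗ[ℂ] H :=
    { toFun := fun b => π b ξ
      map_add' := fun b c => by rw [map_add]; rfl
      map_smul' := fun c b => by rw [map_smul]; rfl }
  have hM := hπ.2 (LinearMap.range L).topologicalClosure
    (Submodule.isClosed_topologicalClosure _) fun b η hη =>
      map_mem_closure (π b).continuous hη (by
        rintro _ ⟨c, rfl⟩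
        exact ⟨b * c, rep_mul_apply b c ξ⟩)
  rcases hM with h | h
  · exfalso
    have : π a ξ ∈ (LinearMap.range L).topologicalClosure :=
      Submodule.le_topologicalClosure _ ⟨a, rfl⟩
    rw [h, Submodule.mem_bot] at this
    exact ha this
  · intro η
    have : η ∈ (LinearMap.range L).topologicalClosure := h ▸ Submodule.mem_top
    exact this

end Irreducible

/-! ### The orthonormal basis given by the minimal projections -/

section Basis

variable {A : Type u} [CStarAlgebra A] {Y : Type w}
  {j : lp (fun _ : Y => ℂ) ∞ →⋆ₙₐ[ℂ] A}
  {H : Type v} [NormedAddCommGroup H] [InnerProductSpace ℂ H] [CompleteSpace H]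
  {π : A →⋆ₙₐ[ℂ] (H →L[ℂ] H)}

theorem IsDiagonal.exists_unit_vector (hj : IsDiagonal j) (hinj : Function.Injective π) (y : Y) :
    ∃ e : H, ‖e‖ = 1 ∧ π (minProj j y) e = e := by
  obtain ⟨ξ, hξ⟩ := DFunLike.ne_iff.1 ((map_ne_zero_iff π hinj).2 (hj.minProj_ne_zero y))
  refine ⟨((‖π (minProj j y) ξ‖ : ℂ)⁻¹) • π (minProj j y) ξ, ?_, ?_⟩
  · rw [norm_smul, norm_inv, Complex.norm_real, norm_norm]
    exact inv_mul_cancel₀ (norm_ne_zero_iff.2 hξ)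
  · rw [map_smul, ← rep_mul_apply, minProj_mul_self]

/-- Both sides are continuous in `η`, and `e` is cyclic. On the orbit, `p a e = p a p e = c e` by
scalarity of the corner. -/
theorem IsDiagonal.minProj_apply (hj : IsDiagonal j) (hπ : IsIrreducibleRep π) {y : Y} {e : H}
    (he : ‖e‖ = 1) (hpe : π (minProj j y) e = e) (η : H) :
    π (minProj j y) η = (inner ℂ e η : ℂ) • e := by
  have hd : Dense (Set.range fun b => π b e) := hπ.dense_orbit (a := minProj j y) (by
    rw [hpe]; exact norm_ne_zero_iff.1 (he ▸ one_ne_zero))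
  have hc : IsClosed {η | π (minProj j y) η = (inner ℂ e η : ℂ) • e} :=
    isClosed_eq (by fun_prop) (by fun_prop)
  refine hc.closure_subset_iff.2 ?_ (hd η)
  rintro _ ⟨a, rfl⟩
  obtain ⟨c, hc⟩ := hj.exists_corner a y
  have h1 : π (minProj j y) (π a e) = c • e := by
    conv_lhs => rw [← hpe]
    rw [← rep_mul_apply, ← rep_mul_apply, hc, map_smul]
    conv_rhs => rw [← hpe]
    rfl
  have h2 : inner ℂ e (π a e) = c := by
    conv_lhs => rw [← hpe]
    rw [rep_inner_left, star_minProj, hpe, h1, inner_smul_right, inner_self_eq_norm_sq_to_K, he]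
    simp
  change π (minProj j y) (π a e) = (inner ℂ e (π a e) : ℂ) • e
  rw [h1, h2]

theorem rep_mul_minProj_mul_star (hj : IsDiagonal j) (hπ : IsIrreducibleRep π) {y : Y} {e : H}
    (he : ‖e‖ = 1) (hpe : π (minProj j y) e = e) (a : A) :
    π (a * minProj j y * star a) = InnerProductSpace.rankOne ℂ (π a e) (π a e) := by
  ext ξ
  rw [rep_mul_apply, rep_mul_apply, hj.minProj_apply hπ he hpe, map_smul,
    InnerProductSpace.rankOne_apply, rep_inner_left]

/-- All rank one projections belong to the range of an irreducible faithful representation. -/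
theorem exists_rep_eq_rankOne [Nonempty Y] (hj : IsDiagonal j) (hπ : IsIrreducibleRep π)
    (hinj : Function.Injective π) (η : H) : ∃ k, π k = InnerProductSpace.rankOne ℂ η η := by
  obtain ⟨y⟩ := ‹Nonempty Y›
  obtain ⟨e, he, hpe⟩ := hj.exists_unit_vector hinj y
  have hd : Dense (Set.range fun b => π b e) := hπ.dense_orbit (a := minProj j y) (by
    rw [hpe]; exact norm_ne_zero_iff.1 (he ▸ one_ne_zero))
  have hcl : IsClosed (Set.range π) :=
    (NonUnitalStarAlgHom.isometry π hinj).isClosedEmbedding.isClosed_range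
  have hcont : Continuous fun ξ : H => InnerProductSpace.rankOne ℂ ξ ξ :=
    (ContinuousLinearMap.smulRightL ℂ H H).continuous₂.comp
      ((innerSL ℂ (E := H)).continuous.prodMk continuous_id)
  -- The range of `π` is closed and contains the operators for the dense set of vectors `π a e`,
  -- namely the images of `a p_y a*`.
  refine (hcl.preimage hcont).closure_subset_iff.2 ?_ (hd η)
  rintro _ ⟨a, rfl⟩
  exact ⟨_, rep_mul_minProj_mul_star hj hπ he hpe a⟩

/-- If no nonzero element is annihilated by all minimal projections of the diagonal, every
irreducible faithful representation is unitarily equivalent to one on `ℓ²(Y)` in which the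
minimal projections act as coordinate projections. -/
theorem exists_unitary [Nonempty Y] (hj : IsDiagonal j)
    (hfaith : ∀ a, (∀ y, minProj j y * a = 0) → a = 0)
    (hπ : IsIrreducibleRep π) (hinj : Function.Injective π) :
    ∃ v : EllTwo Y ≃ₗᵢ[ℂ] H, ∀ y (ξ : EllTwo Y),
      v.conjStarAlgEquiv.symm (π (minProj j y)) ξ = ξ y • delta y := by
  classical
  choose e he hpe using hj.exists_unit_vector (π := π) hinj
  have hon : Orthonormal ℂ e := by
    refine ⟨he, fun x y hxy => ?_⟩
    change inner ℂ (e x) (e y) = (0 : ℂ)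
    rw [← hpe x, ← hpe y, rep_inner_left, star_minProj, ← rep_mul_apply, minProj_mul_of_ne hxy,
      map_zero, zero_apply, inner_zero_right]
  have hbot : (Submodule.span ℂ (Set.range e))ᗮ = ⊥ := by
    rw [eq_bot_iff]
    intro η hη
    rw [Submodule.mem_bot]
    -- For `η` orthogonal to the family, the operator `⟨η, ·⟩ η` comes from `A` and is killed by
    -- every `p_y`, hence is zero.
    obtain ⟨k, hk⟩ := exists_rep_eq_rankOne hj hπ hinj η
    have hk0 : k = 0 := hfaith k fun y => by
      apply hinj
      ext ξ
      have h0 : inner ℂ (e y) η = (0 : ℂ) :=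
        Submodule.mem_orthogonal _ _ |>.1 hη _ (Submodule.subset_span ⟨y, rfl⟩)
      rw [rep_mul_apply, hk, InnerProductSpace.rankOne_apply, map_smul,
        hj.minProj_apply hπ (he y) (hpe y), h0, zero_smul, smul_zero, map_zero, zero_apply]
    rw [hk0, map_zero, eq_comm, InnerProductSpace.rankOne_eq_zero, or_self] at hk
    exact hk
  let b := HilbertBasis.mkOfOrthogonalEqBot hon hbot
  have hb : ∀ y, b y = e y := fun y => by rw [HilbertBasis.coe_mkOfOrthogonalEqBot]
  refine ⟨b.repr.symm, fun y ξ => ?_⟩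
  rw [LinearIsometryEquiv.symm_conjStarAlgEquiv_apply_apply, hj.minProj_apply hπ (he y) (hpe y),
    map_smul, LinearIsometryEquiv.symm_symm, ← hb, b.repr_self, ← b.repr_apply_apply,
    LinearIsometryEquiv.apply_symm_apply, delta]

end Basis

/-! ### Operators on `ℓ²(Y)` -/

section Operators

variable {Y : Type u}

theorem delta_apply_self (x : Y) : (delta x : EllTwo Y) x = 1 := by
  classical
  rw [delta, lp.single_apply_self]

theorem norm_delta (x : Y) : ‖(delta x : EllTwo Y)‖ = 1 := by
  classical
  rw [delta, lp.norm_single (by norm_num), norm_one]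

theorem inner_delta_left (x : Y) (ξ : EllTwo Y) : inner ℂ (delta x) ξ = ξ x := by
  classical
  rw [delta, lp.inner_single_left]
  simp

theorem matrixEntry_eq (T : EllTwo Y →L[ℂ] EllTwo Y) (x y : Y) :
    matrixEntry T x y = T (delta y) x := inner_delta_left _ _

theorem norm_matrixEntry_le (T : EllTwo Y →L[ℂ] EllTwo Y) (x y : Y) :
    ‖matrixEntry T x y‖ ≤ ‖T‖ := by
  refine (norm_inner_le_norm _ _).trans ?_
  rw [norm_delta, one_mul]
  simpa [norm_delta] using T.le_opNorm (delta y)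

theorem eq_zero_of_matrixEntry {T : EllTwo Y →L[ℂ] EllTwo Y}
    (h : ∀ x y, matrixEntry T x y = 0) : T = 0 := by
  classical
  have hδ : ∀ y, T (delta y) = 0 := fun y => by
    ext x
    rw [← matrixEntry_eq, h]; rfl
  ext1 ξ
  have hs := (lp.hasSum_single (p := 2) (by simp) ξ).mapL T
  have h0 : ∀ y, T (lp.single 2 y (ξ y)) = 0 := fun y => by
    have : lp.single 2 y (ξ y) = ξ y • (delta y : EllTwo Y) := by
      rw [delta, ← lp.single_smul, smul_eq_mul, mul_one]
    rw [this, map_smul, hδ, smul_zero]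
  simp only [h0] at hs
  exact hs.unique hasSum_zero

theorem matrixEntry_mul_ne_zero {S T : EllTwo Y →L[ℂ] EllTwo Y} {x z : Y}
    (h : matrixEntry (S * T) x z ≠ 0) : ∃ y, matrixEntry S x y ≠ 0 ∧ matrixEntry T y z ≠ 0 := by
  by_contra! hy
  apply h
  have h1 : matrixEntry (S * T) x z = inner ℂ (star S (delta x)) (T (delta z)) := by
    rw [ContinuousLinearMap.star_eq_adjoint, ContinuousLinearMap.adjoint_inner_left]; rfl
  rw [h1, lp.inner_eq_tsum]
  have h2 : ∀ y, inner ℂ ((star S (delta x)) y) ((T (delta z)) y) = (0 : ℂ) := fun y => by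
    by_cases hS : matrixEntry S x y = 0
    · have : (star S (delta x)) y = 0 := by
        rw [← inner_delta_left, ContinuousLinearMap.star_eq_adjoint,
          ContinuousLinearMap.adjoint_inner_right, ← inner_conj_symm, ← matrixEntry.eq_1, hS,
          map_zero]
      rw [this, inner_zero_left]
    · have : (T (delta z)) y = 0 := by rw [← matrixEntry_eq, hy y hS]
      rw [this, inner_zero_right]
  simp only [h2, tsum_zero]

theorem matrixEntry_star (T : EllTwo Y →L[ℂ] EllTwo Y) (x y : Y) :
    matrixEntry (star T) x y = starRingEnd ℂ (matrixEntry T y x) := by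
  rw [matrixEntry, matrixEntry, ContinuousLinearMap.star_eq_adjoint,
    ContinuousLinearMap.adjoint_inner_right, inner_conj_symm]

theorem matrixEntry_add (S T : EllTwo Y →L[ℂ] EllTwo Y) (x y : Y) :
    matrixEntry (S + T) x y = matrixEntry S x y + matrixEntry T x y := inner_add_right _ _ _

theorem matrixEntry_sub (S T : EllTwo Y →L[ℂ] EllTwo Y) (x y : Y) :
    matrixEntry (S - T) x y = matrixEntry S x y - matrixEntry T x y := inner_sub_right _ _ _

theorem matrixEntry_smul (c : ℂ) (T : EllTwo Y →L[ℂ] EllTwo Y) (x y : Y) :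
    matrixEntry (c • T) x y = c * matrixEntry T x y := inner_smul_right _ _ _

theorem matrixEntry_zero (x y : Y) : matrixEntry (0 : EllTwo Y →L[ℂ] EllTwo Y) x y = 0 :=
  inner_zero_right _

theorem matrixEntry_mulOperator_mul (f : lp (fun _ : Y => ℂ) ∞) (T : EllTwo Y →L[ℂ] EllTwo Y)
    (x y : Y) : matrixEntry (mulOperator f * T) x y = f x * matrixEntry T x y := by
  rw [matrixEntry_eq, matrixEntry_eq]; rfl

section Propagation

variable [MetricSpace Y]

theorem propagation_lt_top_iff {T : EllTwo Y →L[ℂ] EllTwo Y} :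
    propagation T < ∞ ↔ ∃ r : ℝ, ∀ x y, matrixEntry T x y ≠ 0 → dist x y ≤ r := by
  constructor
  · intro h
    refine ⟨(propagation T).toReal, fun x y hxy => ?_⟩
    rw [dist_edist]
    refine ENNReal.toReal_mono h.ne ?_
    exact le_iSup_of_le x (le_iSup_of_le y (le_iSup_of_le hxy le_rfl))
  · rintro ⟨r, hr⟩
    refine lt_of_le_of_lt ?_ (ENNReal.ofReal_lt_top (r := r))
    refine iSup_le fun x => iSup_le fun y => iSup_le fun hxy => ?_
    rw [edist_dist]
    exact ENNReal.ofReal_le_ofReal (hr x y hxy)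

variable (Y) in
/-- The `*`-algebra of operators of finite propagation. -/
def finitePropagation : NonUnitalStarSubalgebra ℂ (EllTwo Y →L[ℂ] EllTwo Y) where
  carrier := {T | propagation T < ∞}
  zero_mem' := propagation_lt_top_iff.2 ⟨0, fun x y h => absurd (matrixEntry_zero x y) h⟩
  add_mem' {S T} hS hT := by
    obtain ⟨r, hr⟩ := propagation_lt_top_iff.1 hS
    obtain ⟨r', hr'⟩ := propagation_lt_top_iff.1 hT
    refine propagation_lt_top_iff.2 ⟨max r r', fun x y h => ?_⟩
    by_cases h0 : matrixEntry S x y = 0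
    · rw [matrixEntry_add, h0, zero_add] at h
      exact (hr' x y h).trans (le_max_right _ _)
    · exact (hr x y h0).trans (le_max_left _ _)
  mul_mem' {S T} hS hT := by
    obtain ⟨r, hr⟩ := propagation_lt_top_iff.1 hS
    obtain ⟨r', hr'⟩ := propagation_lt_top_iff.1 hT
    refine propagation_lt_top_iff.2 ⟨r + r', fun x z h => ?_⟩
    obtain ⟨y, hxy, hyz⟩ := matrixEntry_mul_ne_zero h
    exact (dist_triangle x y z).trans (add_le_add (hr x y hxy) (hr' y z hyz))
  smul_mem' c T hT := by
    obtain ⟨r, hr⟩ := propagation_lt_top_iff.1 hT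
    refine propagation_lt_top_iff.2 ⟨r, fun x y h => hr x y fun h0 => h ?_⟩
    rw [matrixEntry_smul, h0, mul_zero]
  star_mem' {T} hT := by
    obtain ⟨r, hr⟩ := propagation_lt_top_iff.1 hT
    refine propagation_lt_top_iff.2 ⟨r, fun x y h => ?_⟩
    rw [dist_comm]
    refine hr y x fun h0 => h ?_
    rw [matrixEntry_star, h0, map_zero]

end Propagation

end Operators

/-! ### Representations on `ℓ²(Y)` with diagonal minimal projections -/

section DiagonalRep

variable {A : Type u} [CStarAlgebra A] {Y : Type v} {j : lp (fun _ : Y => ℂ) ∞ →⋆ₙₐ[ℂ] A}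
  {ρ : A →⋆ₙₐ[ℂ] (EllTwo Y →L[ℂ] EllTwo Y)}
  (hρ : ∀ y (ξ : EllTwo Y), ρ (minProj j y) ξ = ξ y • delta y)
include hρ

/-- Coordinate `y` is read off by applying `p_y j(f) = f(y) p_y` to `ξ`. -/
theorem rep_map (f : lp (fun _ : Y => ℂ) ∞) : ρ (j f) = mulOperator f := by
  ext ξ y
  rw [mulOperator_apply]
  have h := rep_mul_apply (π := ρ) (minProj j y) (j f) ξ
  rw [minProj_mul_map, map_smul, hρ, smul_apply, hρ] at h
  have := congrArg (fun ζ : EllTwo Y => ζ y) h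
  simpa [lp.coeFn_smul, delta_apply_self] using this.symm

/-- This links the intrinsic entries to the matrix: `p_x a p_y` acts as the scalar entry times a
rank one operator of norm one. -/
theorem norm_matrixEntry_rep (hinj : Function.Injective ρ) (a : A) (x y : Y) :
    ‖matrixEntry (ρ a) x y‖ = entry j a x y := by
  have h : ρ (minProj j x * a * minProj j y) =
      matrixEntry (ρ a) x y • InnerProductSpace.rankOne ℂ (delta x) (delta y) := by
    ext1 ξ
    rw [rep_mul_apply, rep_mul_apply, hρ, hρ, smul_apply,
      InnerProductSpace.rankOne_apply, inner_delta_left, map_smul, matrixEntry_eq, smul_smul]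
    simp [mul_comm]
  rw [entry, ← NonUnitalStarAlgHom.norm_map ρ hinj, h, norm_smul,
    InnerProductSpace.norm_rankOne, norm_delta, norm_delta, mul_one, mul_one]

/-- Induction on the cover: the part of `T` carried by the large entries of one normaliser `s` is `g
s` for a bounded function `g`; the remainder is covered by the other normalisers. -/
theorem mem_range_of_finite_cover (hj : IsDiagonal j) (hinj : Function.Injective ρ) {F : Set A}
    (hF : F.Finite) (hFn : F ⊆ normaliser (NonUnitalStarAlgHom.range j)) {ε : ℝ} (hε : 0 < ε)
    (T : EllTwo Y →L[ℂ] EllTwo Y)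
    (hT : ∀ x y, matrixEntry T x y ≠ 0 → ∃ s ∈ F, ε ≤ entry j s x y) : T ∈ Set.range ρ := by
  classical
  induction F, hF using Set.Finite.induction_on generalizing T with
  | empty =>
    refine ⟨0, ?_⟩
    rw [map_zero, eq_comm]
    refine eq_zero_of_matrixEntry fun x y => ?_
    by_contra h
    simpa using hT x y h
  | @insert s F _ _ ih =>
    have hs : s ∈ normaliser (NonUnitalStarAlgHom.range j) := hFn (Set.mem_insert _ _)
    -- A row of `s` has at most one large entry; `g` is the quotient of the entries of `T` and `s`
    -- there.
    let g : Y → ℂ := fun x => if h : ∃ y, ε ≤ entry j s x y then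
      matrixEntry T x h.choose / matrixEntry (ρ s) x h.choose else 0
    have hg : ∀ x y, ε ≤ entry j s x y → g x * matrixEntry (ρ s) x y = matrixEntry T x y := by
      intro x y hxy
      have h : ∃ y, ε ≤ entry j s x y := ⟨y, hxy⟩
      have hy : h.choose = y := hj.eq_of_entry_ne_zero_right hs
        (hε.trans_le h.choose_spec).ne' (hε.trans_le hxy).ne'
      simp only [g, dif_pos h, hy]
      refine div_mul_cancel₀ _ ?_
      rw [← norm_ne_zero_iff, norm_matrixEntry_rep hρ hinj]
      exact (hε.trans_le hxy).ne'
    -- A row with a large entry has no other nonzero entry, and `g` vanishes on the remaining rows,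
    -- so `g s` adds no new support.
    have hg0 : ∀ x y, ¬ ε ≤ entry j s x y → g x * matrixEntry (ρ s) x y = 0 := by
      intro x y hxy
      by_cases h : ∃ y, ε ≤ entry j s x y
      · obtain ⟨z, hz⟩ := h
        rw [mul_eq_zero]
        right
        by_contra hne
        rw [← ne_eq, ← norm_ne_zero_iff, norm_matrixEntry_rep hρ hinj] at hne
        exact hxy (hj.eq_of_entry_ne_zero_right hs (hε.trans_le hz).ne' hne ▸ hz)
      · simp [g, h]
    -- The uniform lower bound `ε` on the entries is what makes `g` bounded.
    have hgb : ∀ x, ‖g x‖ ≤ ‖T‖ / ε := by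
      intro x
      by_cases h : ∃ y, ε ≤ entry j s x y
      · simp only [g, dif_pos h, norm_div]
        have := h.choose_spec
        rw [← norm_matrixEntry_rep hρ hinj] at this
        have h2 := norm_matrixEntry_le T x h.choose
        gcongr
      · simp only [g, dif_neg h, norm_zero]
        positivity
    let f : lp (fun _ : Y => ℂ) ∞ :=
      ⟨g, memℓp_infty ⟨‖T‖ / ε, by rintro _ ⟨x, rfl⟩; exact hgb x⟩⟩
    have hent : ∀ x y, matrixEntry (ρ (j f * s)) x y = g x * matrixEntry (ρ s) x y := by
      intro x y
      rw [map_mul, rep_map hρ, matrixEntry_mulOperator_mul]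
    obtain ⟨a, ha⟩ := ih ((Set.subset_insert _ _).trans hFn) (T - ρ (j f * s)) fun x y hxy => by
      rw [matrixEntry_sub, hent] at hxy
      by_cases h : ε ≤ entry j s x y
      · rw [hg x y h, sub_self] at hxy
        exact absurd rfl hxy
      · rw [hg0 x y h, sub_zero] at hxy
        obtain ⟨t, ht, hle⟩ := hT x y hxy
        rcases Set.mem_insert_iff.1 ht with rfl | ht
        · exact absurd hle h
        · exact ⟨t, ht, hle⟩
    exact ⟨a + j f * s, by rw [map_add, ha, sub_add_cancel]⟩

theorem uniformRoeAlgebra_subset_range [MetricSpace Y] (hj : IsDiagonal j)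
    (hinj : Function.Injective ρ)
    (hcov : ∀ r : ℝ, IsCovered j fun x y : Y => dist x y ≤ r) :
    uniformRoeAlgebra Y ⊆ Set.range ρ := by
  have hcl : IsClosed (Set.range ρ) :=
    (NonUnitalStarAlgHom.isometry ρ hinj).isClosedEmbedding.isClosed_range
  refine hcl.closure_subset_iff.2 fun T hT => ?_
  obtain ⟨r, hr⟩ := propagation_lt_top_iff.1 hT
  obtain ⟨F, hF, hFn, ε, hε, hc⟩ := hcov r
  exact mem_range_of_finite_cover hρ hj hinj hF hFn hε T fun x y h => hc x y (hr x y h)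

theorem propagation_rep_map_lt_top [MetricSpace Y] (hinj : Function.Injective ρ)
    (f : lp (fun _ : Y => ℂ) ∞) : propagation (ρ (j f)) < ∞ := by
  refine propagation_lt_top_iff.2 ⟨0, fun x y h => ?_⟩
  rw [← norm_ne_zero_iff, norm_matrixEntry_rep hρ hinj] at h
  by_contra hxy
  exact h (entry_map_of_ne f fun he => hxy (by rw [he, dist_self]))

/-- A normaliser whose large entries are all at bounded distance from the diagonal, for each
threshold, belongs to the uniform Roe algebra. -/
theorem rep_normaliser_mem [MetricSpace Y] (hj : IsDiagonal j) (hinj : Function.Injective ρ)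
    {s : A} (hs : s ∈ normaliser (NonUnitalStarAlgHom.range j))
    (hd : ∀ k : ℕ, ∃ r : ℝ, ∀ x y, 1 / ((k : ℝ) + 1) ≤ entry j s x y → dist x y ≤ r) :
    ρ s ∈ uniformRoeAlgebra Y := by
  classical
  refine Metric.mem_closure_iff.2 fun ε hε => ?_
  obtain ⟨k, hk⟩ := exists_nat_one_div_lt hε
  obtain ⟨r, hr⟩ := hd k
  -- The indicator of the rows on which `s` is small; `j f * s` is the error and `s - j f * s` the
  -- approximant.
  let g : Y → ℂ := fun x => if ‖minProj j x * s‖ ≤ 1 / ((k : ℝ) + 1) then 1 else 0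
  have hg : ∀ x, ‖g x‖ ≤ 1 := fun x => by
    simp only [g]; split_ifs <;> simp
  let f : lp (fun _ : Y => ℂ) ∞ := ⟨g, memℓp_infty ⟨1, by rintro _ ⟨x, rfl⟩; exact hg x⟩⟩
  have hle : ‖j f * s‖ ≤ 1 / ((k : ℝ) + 1) :=
    hj.norm_map_mul_le hs (by positivity) f hg fun x hx => by
      by_contra h
      exact hx (if_neg h)
  refine ⟨ρ (s - j f * s), ?_, ?_⟩
  · refine propagation_lt_top_iff.2 ⟨r, fun x y h => hr x y ?_⟩
    rw [map_sub, map_mul, rep_map hρ, matrixEntry_sub, matrixEntry_mulOperator_mul] at h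
    have hxy : matrixEntry (ρ s) x y ≠ 0 := fun h0 => h (by rw [h0, mul_zero, sub_zero])
    have hx : ¬ ‖minProj j x * s‖ ≤ 1 / ((k : ℝ) + 1) := fun hx =>
      h (by rw [show f x = 1 from if_pos hx, one_mul, sub_self])
    rw [← norm_ne_zero_iff, norm_matrixEntry_rep hρ hinj] at hxy
    -- The nonzero entry is the whole row, so a large row norm means a large entry.
    rw [entry, ← hj.minProj_mul_eq hs hxy]
    exact (not_le.1 hx).le
  · rw [dist_eq_norm, ← map_sub, sub_sub_cancel, NonUnitalStarAlgHom.norm_map ρ hinj]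
    exact hle.trans_lt hk

theorem range_subset_uniformRoeAlgebra [MetricSpace Y] (hj : IsDiagonal j)
    (hinj : Function.Injective ρ) {N : Set A}
    (hN : N ⊆ normaliser (NonUnitalStarAlgHom.range j))
    (hgen : generatedCStarSubalgebra (N ∪ Set.range j) = ⊤)
    (hd : ∀ s ∈ N, ∀ k : ℕ, ∃ r : ℝ, ∀ x y, 1 / ((k : ℝ) + 1) ≤ entry j s x y → dist x y ≤ r) :
    Set.range ρ ⊆ uniformRoeAlgebra Y := by
  have hcl : IsClosed ((finitePropagation Y).topologicalClosure.comap ρ : Set A) :=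
    isClosed_closure.preimage (NonUnitalStarAlgHom.isometry ρ hinj).continuous
  have hsub : N ∪ Set.range j ⊆ (finitePropagation Y).topologicalClosure.comap ρ := by
    rintro _ (hs | ⟨f, rfl⟩)
    · exact rep_normaliser_mem hρ hj hinj (hN hs) (hd _ hs)
    · exact subset_closure (propagation_rep_map_lt_top hρ hinj f)
  have := generatedCStarSubalgebra_le hcl hsub
  rw [hgen] at this
  rintro _ ⟨a, rfl⟩
  exact this (show a ∈ (⊤ : NonUnitalStarSubalgebra ℂ A) from trivial)

end DiagonalRep

/-! ### From Roe Cartan pairs to diagonal embeddings -/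

section Cartan

variable {A : Type u} [CStarAlgebra A] {B : NonUnitalStarSubalgebra ℂ A}

/-- A maximal abelian self-adjoint subalgebra contains the self-adjoint elements of its
commutant. -/
theorem IsMASA.mem_of_commute (hB : IsMASA B) {a : A} (ha : IsSelfAdjoint a)
    (h : ∀ b ∈ B, a * b = b * a) : a ∈ B := by
  have hmem : ∀ x ∈ insert a (B : Set A), ∀ y ∈ insert a (B : Set A), x * y = y * x := by
    rintro x (rfl | hx) y (rfl | hy)
    · rfl
    · exact h y hy
    · exact (h x hx).symm
    · exact hB.1 x hx y hy
  have hstar : ∀ x ∈ insert a (B : Set A), star x ∈ insert a (B : Set A) := by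
    rintro x (rfl | hx)
    · exact .inl ha.star_eq
    · exact .inr (star_mem hx)
  have hab : IsAbelian (NonUnitalStarAlgebra.adjoin ℂ (insert a (B : Set A))) := by
    have := NonUnitalStarAlgebra.isMulCommutative_adjoin ℂ hmem
      fun x hx y hy => hmem x hx _ (hstar y hy)
    intro x hx y hy
    exact congrArg Subtype.val (this.is_comm.comm ⟨x, hx⟩ ⟨y, hy⟩)
  have hsub := NonUnitalStarAlgebra.subset_adjoin ℂ (insert a (B : Set A))
  rw [← hB.2 _ hab fun b hb => hsub (.inr hb)]
  exact hsub (.inl rfl)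

theorem IsCartanSubalgebra.exists_isDiagonal (hB : IsCartanSubalgebra B) {Y : Type v}
    (φ : B ≃⋆ₐ[ℂ] lp (fun _ : Y => ℂ) ∞) :
    ∃ j : lp (fun _ : Y => ℂ) ∞ →⋆ₙₐ[ℂ] A, IsDiagonal j ∧ NonUnitalStarAlgHom.range j = B := by
  let j : lp (fun _ : Y => ℂ) ∞ →⋆ₙₐ[ℂ] A :=
    (NonUnitalStarSubalgebraClass.subtype B).comp (φ.symm : lp (fun _ : Y => ℂ) ∞ →⋆ₙₐ[ℂ] B)
  have hj : ∀ f, j f = φ.symm f := fun f => rfl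
  have hr : ∀ b ∈ B, ∃ f, j f = b := fun b hb =>
    ⟨φ ⟨b, hb⟩, by rw [hj, φ.symm_apply_apply]⟩
  refine ⟨j, ⟨fun f g h => φ.symm.injective (Subtype.ext h), fun a ha h => hr a ?_⟩, ?_⟩
  · refine hB.isMASA.mem_of_commute ha fun b hb => ?_
    obtain ⟨f, rfl⟩ := hr b hb
    exact h f
  · ext a
    refine ⟨?_, fun ha => hr a ha⟩
    rintro ⟨f, rfl⟩
    exact (φ.symm f).2

/-- By faithfulness of the conditional expectation, no nonzero element is annihilated by all
minimal projections of the diagonal. -/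
theorem eq_zero_of_minProj_mul {Y : Type v} {j : lp (fun _ : Y => ℂ) ∞ →⋆ₙₐ[ℂ] A}
    (hj : IsDiagonal j) (hB : IsCartanSubalgebra (NonUnitalStarAlgHom.range j)) (a : A)
    (ha : ∀ y, minProj j y * a = 0) : a = 0 := by
  classical
  obtain ⟨E, hE, hEf⟩ := hB.expectation
  -- The hypothesis multiplies `a` on the left, so faithfulness is used for `star a`: by the module
  -- property `E (a a*)` has all coordinates zero.
  suffices h : E (star (star a) * star a) = 0 from star_eq_zero.1 (hEf _ h)
  rw [star_star]
  obtain ⟨f, hf⟩ := (E (a * star a)).2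
  have hf' : j f = E (a * star a) := hf
  have h0 : f = 0 := by
    ext y
    refine hj.apply_eq_zero ?_
    have := hE.map_mul_left ⟨minProj j y, ⟨_, rfl⟩⟩ (a * star a)
    rw [← mul_assoc, ha, zero_mul, map_zero] at this
    rw [hf']
    exact (congrArg Subtype.val this).symm
  apply Subtype.ext
  rw [← hf', h0, map_zero]
  rfl

end Cartan

/-! ### The chain metric and transport of representations -/

section Main

variable {A : Type u} [CStarAlgebra A] {Y : Type v} {j : lp (fun _ : Y => ℂ) ∞ →⋆ₙₐ[ℂ] A}
  {N : ℕ → A}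

theorem IsDiagonal.isCovered_dist_le (hj : IsDiagonal j)
    (hN : ∀ i, N i ∈ normaliser (NonUnitalStarAlgHom.range j))
    (htot : ∀ x y, ∃ i, entry j (N i) x y ≠ 0) (r : ℝ) :
    letI := chainMetric (R := seqRel j N) seqRel_symm (seqRel_total htot)
    IsCovered j fun x y => dist x y ≤ r := by
  -- Distances are natural numbers, so the ball is the union of the relations `Reach n` over `n ≤
  -- ⌊r⌋`.
  refine (IsCovered.exists_lt (⌊r⌋₊ + 1) fun n _ =>
    hj.isCovered_reach (isCovered_seqRel hN) n).mono fun x y hxy => ?_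
  refine ⟨chainDist (seqRel j N) x y, ?_, reach_chainDist (seqRel_total htot) x y⟩
  exact Nat.lt_succ_of_le (Nat.le_floor hxy)

theorem IsDiagonal.boundedGeometry {Y : Type v} {j : lp (fun _ : Y => ℂ) ∞ →⋆ₙₐ[ℂ] A}
    [MetricSpace Y] (hj : IsDiagonal j) (hcov : ∀ r : ℝ, IsCovered j fun x y : Y => dist x y ≤ r) :
    BoundedGeometry Y := fun r _ => by
  obtain ⟨n, hn⟩ := hj.exists_encard_le (hcov r)
  refine ⟨n, fun y => ?_⟩
  convert hn y using 2
  ext x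
  rw [Metric.mem_closedBall', Set.mem_ofPred_eq]

/-- The representation on `K` obtained from one on `H` and a unitary `v : K → H`. -/
def conjRep {A : Type u} [NonUnitalCStarAlgebra A] {H : Type v} [NormedAddCommGroup H]
    [InnerProductSpace ℂ H] [CompleteSpace H] {K : Type w} [NormedAddCommGroup K]
    [InnerProductSpace ℂ K] [CompleteSpace K] (v : K ≃ₗᵢ[ℂ] H) (π : A →⋆ₙₐ[ℂ] (H →L[ℂ] H)) :
    A →⋆ₙₐ[ℂ] (K →L[ℂ] K) where
  toFun a := v.conjStarAlgEquiv.symm (π a)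
  map_smul' c a := by simp only [map_smul, MonoidHom.id_apply]
  map_zero' := by rw [map_zero, map_zero]
  map_add' a b := by rw [map_add, map_add]
  map_mul' a b := by rw [map_mul, map_mul]
  map_star' a := by rw [map_star, map_star]

end Main

end RoeCartan

end

theorem theoremB {A : Type u} [CStarAlgebra A] (B : NonUnitalStarSubalgebra ℂ A)
    (hB : RoeCartan.IsRoeCartanPair.{u, w} B) :
    ∃ (Y : Type) (_ : MetricSpace Y), RoeCartan.BoundedGeometry Y ∧
      ∀ (H : Type v) [NormedAddCommGroup H] [InnerProductSpace ℂ H] [CompleteSpace H]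
        (π : A →⋆ₙₐ[ℂ] (H →L[ℂ] H)),
        RoeCartan.IsIrreducibleRep π → Function.Injective π →
          ∃ v : RoeCartan.EllTwo Y ≃ₗᵢ[ℂ] H,
            {T | ∃ b ∈ B, T = v.conjStarAlgEquiv.symm (π b)} = RoeCartan.ellInftyOperators Y ∧
            {T | ∃ a : A, T = v.conjStarAlgEquiv.symm (π a)} = RoeCartan.uniformRoeAlgebra Y := by
  obtain ⟨hcomp, hcart, hsep, ⟨φ⟩⟩ := hB
  obtain ⟨j, hj, rfl⟩ := hcart.exists_isDiagonal φ
  obtain ⟨N, hN, htot, hgen⟩ := RoeCartan.exists_seq_normalisers hj hcomp hcart.regular hsep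
  let m := RoeCartan.chainMetric (R := RoeCartan.seqRel j N) RoeCartan.seqRel_symm
    (RoeCartan.seqRel_total htot)
  have hcov := hj.isCovered_dist_le hN htot
  -- The metric space is fixed before any representation is considered.
  refine ⟨ℕ, m, @RoeCartan.IsDiagonal.boundedGeometry _ _ _ _ m hj hcov, ?_⟩
  intro H _ _ _ π hπ hinj
  obtain ⟨v, hv⟩ := RoeCartan.exists_unitary hj (RoeCartan.eq_zero_of_minProj_mul hj hcart) hπ hinj
  let ρ : A →⋆ₙₐ[ℂ] (RoeCartan.EllTwo ℕ →L[ℂ] RoeCartan.EllTwo ℕ) := RoeCartan.conjRep v π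
  have hρinj : Function.Injective ρ := v.conjStarAlgEquiv.symm.injective.comp hinj
  refine ⟨v, ?_, ?_⟩
  · ext T
    constructor
    · rintro ⟨_, ⟨f, rfl⟩, rfl⟩
      exact ⟨f, (RoeCartan.rep_map (ρ := ρ) hv f).symm⟩
    · rintro ⟨f, rfl⟩
      exact ⟨j f, ⟨f, rfl⟩, (RoeCartan.rep_map (ρ := ρ) hv f).symm⟩
  · have h1 := @RoeCartan.range_subset_uniformRoeAlgebra _ _ _ j ρ hv m hj hρinj (Set.range N)
      (by rintro _ ⟨i, rfl⟩; exact hN i) hgen (by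
        rintro _ ⟨i, rfl⟩ k
        -- An entry of `N i` of size at least `1 / (k + 1)` is a single step, so the distance is at
        -- most `Nat.pair i k + 1`.
        exact ⟨_, fun x y h => Nat.cast_le.2 <| RoeCartan.chainDist_le
          (RoeCartan.Reach.single (RoeCartan.seqRel_pair h))⟩)
    have h2 := @RoeCartan.uniformRoeAlgebra_subset_range _ _ _ j ρ hv m hj hρinj hcov
    rw [← h1.antisymm h2]
    ext T
    exact ⟨fun ⟨a, ha⟩ => ⟨a, ha.symm⟩, fun ⟨a, ha⟩ => ⟨a, ha.symm⟩⟩
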